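/- **Reverse water-filling with a common water level.** Let $\mathcal S\subset\mathbb Z^d$ be a finite lattice partitioned into nonempty regions $\mathcal S_1,\dots,\mathcal S_K$, and put $n_r=|\mathcal S_r|$, $w_r=|\mathcal S_r|/|\mathcal S|$. Let $X=(X(s))_{s\in\mathcal S}$ be a piecewise homogeneous Gaussian random field: $X$ is jointly Gaussian; there are $m_r\in\mathbb R$ and positive semidefinite functions $\Gamma_r:\mathbb Z^d\to\mathbb R$ with $\mathbb E[X(s)]=m_r$ and $\operatorname{Cov}(X(s),X(t))=\Gamma_r(s-t)$ for $s,t\in\mathcal S_r$; and $\operatorname{Cov}(X(s),X(t))=0$ whenever $s,t$ lie in different regions. Let $X_r=(X(s))_{s\in\mathcal S_r}$, and let $\lambda_{r,1},\dots,\lambda_{r,n_r}\ge 0$ be the eigenvalues, with multiplicity, of the covariance matrix of $X_r$. With $d(x,\hat x)=\frac1{|\mathcal S|}\sum_{s\in\mathcal S}(x(s)-\hat x(s))^2$ and $d_r(x_r,\hat x_r)=\frac1{n_r}\sum_{s\in\mathcal S_r}(x(s)-\hat x(s))^2$, define the per-site rate–distortion functions (in nats) $$R(D)=\inf_{P_{\hat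 X|X}:\ \mathbb E[d(X,\hat X)]\le D}\frac1{|\mathcal S|}I(X;\hat X),\qquad R_r(D_r)=\inf_{P_{\hat X_r|X_r}:\ \mathbb E[d_r(X_r,\hat X_r)]\le D_r}\frac1{n_r}I(X_r;\hat X_r),$$ where the infimum of the empty set is $+\infty$. For $\theta\in\mathbb R$ let $D_r(\theta)=\frac1{n_r}\sum_{i=1}^{n_r}\min\{\lambda_{r,i},\theta\}$, and for $\theta>0$ let $R_r(\theta)=\frac1{2n_r}\sum_{i=1}^{n_r}\bigl[\log\frac{\lambda_{r,i}}{\theta}\bigr]^+$ (a zero eigenvalue contributes $0$ to $R_r(\theta)$). Let $0<D<\sum_r w_r\frac1{n_r}\sum_{i}\lambda_{r,i}$. Then there is a $\theta^\star>0$ such that: 1. $\theta^\star$ is the unique real solution $\theta$ of $\sum_r w_r D_r(\theta)=D$. 2. The problem of minimizing $\sum_r w_rR_r(D_r)$ over $(D_r)_r\in\mathbb R^K$ with $\sum_r w_rD_r\le D$ has exactly one minimizer, namely $D_r=D_r(\theta^\star)$ for all $r$. 3. All regions operate at the common water level $\theta^\star$: for every $r$, the regional rate–distortion function at distortion $D_r(\theta^\star)$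 equals $R_r(\theta^\star)=\frac1{2n_r}\sum_i\bigl[\log\frac{\lambda_{r,i}}{\theta^\star}\bigr]^+$; and whenever region $r$ is in the interior regime, $D_r(\theta^\star)<\frac1{n_r}\sum_i\lambda_{r,i}$, the level $\theta^\star$ is the only $\theta$ with $D_r(\theta)=D_r(\theta^\star)$. 4. $R(D)=\sum_r w_rR_r(\theta^\star)=\sum_r w_r\frac1{2n_r}\sum_{i}\bigl[\log\frac{\lambda_{r,i}}{\theta^\star}\bigr]^+$. -/

import Mathlib

open MeasureTheory ProbabilityTheory InformationTheory
open scoped ENNReal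

namespace PiecewiseRD

noncomputable section

/-! ### Rate-distortion functions under normalized squared error -/

/-- Mutual information `I(X; X̂)` (in nats) of a pair with `X ∼ μ` and conditional law
`X̂ | X ∼ κ`: the divergence of the joint law from the product of the two marginals. -/
def mutualInfo {α β : Type*} [MeasurableSpace α] [MeasurableSpace β]
    (μ : Measure α) (κ : Kernel α β) : ℝ≥0∞ :=
  klDiv (μ ⊗ₘ κ) (μ.prod (κ ∘ₘ μ))

/-- Normalized squared error between two real vectors indexed by a finite set of sites. -/
def mse {σ : Type*} [Fintype σ] (x y : σ → ℝ) : ℝ :=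
  (1 / (Fintype.card σ : ℝ)) * ∑ s, (x s - y s) ^ 2

/-- The test channel `κ` has expected distortion (finite and) at most `D` for the source law `μ`. -/
def MeetsDistortion {σ : Type*} [Fintype σ] (μ : Measure (σ → ℝ))
    (κ : Kernel (σ → ℝ) (σ → ℝ)) (D : ℝ) : Prop :=
  Integrable (fun p : (σ → ℝ) × (σ → ℝ) => mse p.1 p.2) (μ ⊗ₘ κ) ∧
    ∫ p, mse p.1 p.2 ∂(μ ⊗ₘ κ) ≤ D

/-- The per-site rate-distortion function of a source with law `μ`: the infimum of
`I(X; X̂) / |σ|` over all conditional laws of `X̂` given `X` with `E[d(X, X̂)] ≤ D`.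
It is `⊤` if no conditional law is admissible. -/
def rateDistortion {σ : Type*} [Fintype σ] (μ : Measure (σ → ℝ)) (D : ℝ) : ℝ≥0∞ :=
  ⨅ (κ : Kernel (σ → ℝ) (σ → ℝ)) (_ : IsMarkovKernel κ) (_ : MeetsDistortion μ κ D),
    (Fintype.card σ : ℝ≥0∞)⁻¹ * mutualInfo μ κ

/-! ### The piecewise homogeneous Gaussian model -/

/-- `X` is a piecewise homogeneous Gaussian random field on the finite lattice `S ⊂ ℤ^d`.
The partition of `S` into nonempty regions is given by the region label map; `m r` and `Γ r`
are the mean and the covariance function of region `r`. -/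
structure IsPiecewiseGaussian {Ω : Type*} [MeasurableSpace Ω] (P : Measure Ω) {d K : ℕ}
    {S : Finset (Fin d → ℤ)} (label : S → Fin K) (X : Ω → S → ℝ)
    (m : Fin K → ℝ) (Γ : Fin K → (Fin d → ℤ) → ℝ) : Prop where
  /-- every region is nonempty -/
  label_surjective : Function.Surjective label
  /-- each `Γ r` is a symmetric positive semidefinite function on `ℤ^d` -/
  posSemidef : ∀ r, (Matrix.of fun h k : Fin d → ℤ => Γ r (h - k)).PosSemidef
  /-- the field is jointly Gaussian -/
  gaussian : HasGaussianLaw X P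
  /-- the mean is constant on every region -/
  mean_eq : ∀ s, ∫ ω, X ω s ∂P = m (label s)
  /-- the covariance is stationary inside every region -/
  cov_within : ∀ s t, label s = label t →
    cov[fun ω => X ω s, fun ω => X ω t; P] = Γ (label s) (s.1 - t.1)
  /-- the covariance is block diagonal with respect to the partition -/
  cov_across : ∀ s t, label s ≠ label t →
    cov[fun ω => X ω s, fun ω => X ω t; P] = 0

section Field

variable {Ω : Type*} [MeasurableSpace Ω] (P : Measure Ω) {d K : ℕ}
  {S : Finset (Fin d → ℤ)} (label : S → Fin K) (X : Ω → S → ℝ)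

/-- The sites of region `r`. -/
abbrev Region (r : Fin K) : Type := {s : S // label s = r}

/-- The restriction of the field to region `r`. -/
def regionField (r : Fin K) (ω : Ω) : Region label r → ℝ := fun s => X ω s.1

/-- `n_r`, the number of sites of region `r`. -/
def regionSize (r : Fin K) : ℕ := Fintype.card (Region label r)

/-- `w_r = |S_r| / |S|`. -/
def weight (r : Fin K) : ℝ := (regionSize label r : ℝ) / (S.card : ℝ)

/-- The covariance matrix `Σ_r` of region `r`. -/
def covMatrix (r : Fin K) : Matrix (Region label r) (Region label r) ℝ :=
  Matrix.of fun s t => cov[fun ω => X ω s.1, fun ω => X ω t.1; P]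

theorem covMatrix_isHermitian (r : Fin K) : (covMatrix P label X r).IsHermitian := by
  ext s t
  simp [covMatrix, Matrix.conjTranspose_apply, covariance_comm]

/-- The eigenvalues `λ_{r,i}` of `Σ_r`, with multiplicity (indexed by the `n_r` sites). -/
def eig (r : Fin K) (i : Region label r) : ℝ := (covMatrix_isHermitian P label X r).eigenvalues i

/-- The global per-site rate-distortion function `R(D)`. -/
def globalRate (D : ℝ) : ℝ≥0∞ := rateDistortion (P.map X) D

/-- The per-site rate-distortion function `R_r(D_r)` of region `r`. -/
def regionRate (r : Fin K) (D : ℝ) : ℝ≥0∞ := rateDistortion (P.map (regionField label X r)) D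

/-- An allocation `(D_r)_r` of regional distortions respects the total budget `D`. -/
def IsFeasible (D : ℝ) (A : Fin K → ℝ) : Prop := ∑ r, weight label r * A r ≤ D

/-- The rate `∑_r w_r R_r(D_r)` of an allocation. -/
def allocationRate (A : Fin K → ℝ) : ℝ≥0∞ :=
  ∑ r, ENNReal.ofReal (weight label r) * regionRate P label X r (A r)

/-- `A` minimizes `∑_r w_r R_r(D_r)` subject to `∑_r w_r D_r ≤ D`. -/
def IsOptimalAllocation (D : ℝ) (A : Fin K → ℝ) : Prop :=
  IsFeasible label D A ∧
    ∀ B, IsFeasible label D B → allocationRate P label X A ≤ allocationRate P label X B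

/-- `(1/n_r) ∑_i λ_{r,i}`, the variance level of region `r`. -/
def regionVariance (r : Fin K) : ℝ := (1 / (regionSize label r : ℝ)) * ∑ i, eig P label X r i

/-- `D_r(θ) = (1/n_r) ∑_i min{λ_{r,i}, θ}`. -/
def levelDistortion (r : Fin K) (θ : ℝ) : ℝ :=
  (1 / (regionSize label r : ℝ)) * ∑ i, min (eig P label X r i) θ

/-- `R_r(θ) = (1/(2 n_r)) ∑_i [log (λ_{r,i} / θ)]⁺`. A zero eigenvalue contributes `0`, in agreement
with `[log 0]⁺ = [-∞]⁺ = 0`. -/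
def levelRate (r : Fin K) (θ : ℝ) : ℝ :=
  (1 / (2 * (regionSize label r : ℝ))) * ∑ i, max (Real.log (eig P label X r i / θ)) 0

end Field

end

end PiecewiseRD

open PiecewiseRD

/-!
Everything rests on one function, an everywhere defined version `llrSum t v z w` of the
log-likelihood ratio between the joint law of the optimal test channel at water level `t` and the
product of its marginals, for independent Gaussian components of variances `v i`. It is a constant
(the rate) minus `‖z - w‖² / (2 t)` plus a function of the source `z` alone, so its expectation
under an arbitrary channel depends only on the distortion of the channel
(`IsGaussianChart.integral_llrSum`).

*Converse.* For every fixed reproduction `w`, the source average of `exp (llrSum t v · w)` is at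
most one. The variational lower bound on the Kullback-Leibler divergence
(`ofReal_integral_le_klDiv`) then bounds the mutual information of any channel from below by the
expectation of `llrSum`. This says that for every `t` the affine function `D ↦ R(t) + (D(t) - D) /
(2 t)` is a minorant of the rate-distortion function (`IsGaussianChart.le_rateDistortion`).

*Achievability.* The kernel with density `exp (llrSum t v z ·)` with respect to the product of the
laws `N(0, (v i - t)⁺)` attains equality (`IsGaussianChart.rateDistortion_le`).

An orthogonal change of coordinates reduces a Gaussian vector to this situation. For the whole
field the regional eigenbases are put together, since the covariance is block diagonal
(`exists_isGaussianChart_field`). Both the regional and the global rate-distortion functions are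
thus known on the water-filling curve.

*Allocation.* Adding up the minorants of slope `-1 / (2 θ)` over the regions shows that the
allocation `D_r(θ)` with `∑ w_r D_r(θ) = D` is optimal. If another allocation differs from it in
some region, then the minorant of that region can be replaced by one of a slightly different slope
that is strictly larger at the given point (`exists_level_tangent_lt`), so the total rate is
strictly larger. The level `θ` exists by the intermediate value theorem and is unique because the
distortion increases strictly until it reaches the total variance.
-/

open scoped NNReal Matrix

namespace PiecewiseRD

noncomputable section

/-! ### The scalar Gaussian test channel -/

/-- A version of the log-likelihood ratio `log (dP_{x,y} / d(P_x ⊗ P_y))` of the optimal test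
channel for a scalar source `N(0, v)` at water level `t`. For `v > t` it is the log-density of
`N(y, t)` with respect to `N(0, v)`, evaluated at `x`. For `v ≤ t` the optimal reproduction is `y =
0`, where the expression vanishes; its values at `y ≠ 0` matter only for the lower bound, and are
chosen so that the quadratic coefficient of `x - y` does not depend on `v`. -/
def llrTerm (t v : ℝ≥0) (x y : ℝ) : ℝ :=
  max (Real.log (v / t)) 0 / 2 - (x - y) ^ 2 / (2 * t) + x ^ 2 / (2 * max (v : ℝ) t)

/-- Changing a Gaussian law into another one by an exponential density. -/
theorem gaussianReal_withDensity_exp {m m' : ℝ} {v v' : ℝ≥0} (hv : v ≠ 0) (hv' : v' ≠ 0)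
    {g : ℝ → ℝ} (hg : Measurable g)
    (h : ∀ x, g x = Real.log (v / v') / 2 + (x - m) ^ 2 / (2 * v) - (x - m') ^ 2 / (2 * v')) :
    (gaussianReal m v).withDensity (fun x => ENNReal.ofReal (Real.exp (g x))) =
      gaussianReal m' v' := by
  rw [gaussianReal_of_var_ne_zero _ hv, gaussianReal_of_var_ne_zero _ hv',
    ← withDensity_mul _ (measurable_gaussianPDF _ _) (by fun_prop)]
  congr 1
  ext x
  have hv0 : (0 : ℝ) < v := by positivity
  have hv0' : (0 : ℝ) < v' := by positivity
  rw [Pi.mul_apply, gaussianPDF, gaussianPDF, ← ENNReal.ofReal_mul (gaussianPDFReal_nonneg _ _ _)]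
  congr 1
  have hlog : Real.exp (Real.log (v / v' : ℝ) / 2) = √(v / v' : ℝ) := by
    rw [Real.sqrt_eq_rpow, Real.rpow_def_of_pos (by positivity)]
    ring_nf
  have hsqrt : √(2 * Real.pi * v) = √(2 * Real.pi * v') * √(v / v' : ℝ) := by
    rw [← Real.sqrt_mul (by positivity)]
    congr 1
    field_simp
  have hpos : 0 < √(v / v' : ℝ) := Real.sqrt_pos.2 (by positivity)
  rw [gaussianPDFReal, gaussianPDFReal, h, sub_eq_add_neg (_ + _), Real.exp_add, Real.exp_add,
    hlog, hsqrt]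
  have hc : Real.exp (-(x - m) ^ 2 / (2 * v)) * Real.exp ((x - m) ^ 2 / (2 * v)) = 1 := by
    rw [← Real.exp_add, neg_div, neg_add_cancel, Real.exp_zero]
  rw [← neg_div]
  calc _ = (√(2 * Real.pi * v'))⁻¹ * Real.exp (-(x - m') ^ 2 / (2 * v')) *
        (Real.exp (-(x - m) ^ 2 / (2 * v)) * Real.exp ((x - m) ^ 2 / (2 * v))) := by
        field_simp
    _ = _ := by rw [hc, mul_one]

theorem llrTerm_of_lt {t v : ℝ≥0} (ht : 0 < t) (h : t < v) (x y : ℝ) :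
    llrTerm t v x y = Real.log (v / t) / 2 - (x - y) ^ 2 / (2 * t) + x ^ 2 / (2 * v) := by
  have h' : (t : ℝ) < v := by exact_mod_cast h
  have ht' : (0 : ℝ) < t := by exact_mod_cast ht
  rw [llrTerm, max_eq_left h'.le, max_eq_left (Real.log_nonneg ((one_le_div ht').2 h'.le))]

theorem llrTerm_of_le {t v : ℝ≥0} (h : v ≤ t) (x y : ℝ) :
    llrTerm t v x y = y / t * x - y ^ 2 / (2 * t) := by
  have h' : (v : ℝ) ≤ t := by exact_mod_cast h
  rw [llrTerm, max_eq_right h',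
    max_eq_right (Real.log_nonpos (by positivity) (div_le_one_of_le₀ h' t.2))]
  ring

/-- Above the water level, `x` given `y` is `N(y, t)` under the optimal test channel. -/
theorem gaussianReal_withDensity_llrTerm_left {t v : ℝ≥0} (ht : 0 < t) (h : t < v) (y : ℝ) :
    (gaussianReal 0 v).withDensity (fun x => ENNReal.ofReal (Real.exp (llrTerm t v x y))) =
      gaussianReal y t :=
  gaussianReal_withDensity_exp (ht.trans h).ne' ht.ne'
    (by unfold llrTerm; fun_prop)
    fun x => by rw [llrTerm_of_lt ht h]; ring

/-- Above the water level, `y` given `x` is `N(x (v - t) / v, t (v - t) / v)` under the optimal test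
channel. -/
theorem gaussianReal_withDensity_llrTerm_right {t v : ℝ≥0} (ht : 0 < t) (h : t < v) (x : ℝ) :
    (gaussianReal 0 (v - t)).withDensity (fun y => ENNReal.ofReal (Real.exp (llrTerm t v x y))) =
      gaussianReal (x * ((v - t : ℝ≥0) : ℝ) / v) (t * (v - t) / v) := by
  have h0 : 0 < v - t := tsub_pos_of_lt h
  have hv : 0 < v := ht.trans h
  refine gaussianReal_withDensity_exp h0.ne' (by positivity)
    (by unfold llrTerm; fun_prop) fun y => ?_
  have hs : ((v - t : ℝ≥0) : ℝ) = v - t := NNReal.coe_sub h.le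
  have h0' : (v : ℝ) - t ≠ 0 := by rw [← hs]; exact_mod_cast h0.ne'
  have ht' : (t : ℝ) ≠ 0 := by exact_mod_cast ht.ne'
  have hv' : (v : ℝ) ≠ 0 := by exact_mod_cast hv.ne'
  rw [llrTerm_of_lt ht h]
  push_cast
  rw [hs]
  have e : ((v : ℝ) - t) / (t * (v - t) / v) = v / t := by field_simp
  rw [e]
  field_simp
  ring

/-- `y ↦ exp (llrTerm t v x y)` is a probability density with respect to the optimal output law
`N(0, v - t)`, for every `x`; below the water level the truncated difference `v - t` is `0` and the
output law is the point mass at `0`. -/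
theorem lintegral_exp_llrTerm_right {t v : ℝ≥0} (ht : 0 < t) (x : ℝ) :
    ∫⁻ y, ENNReal.ofReal (Real.exp (llrTerm t v x y)) ∂(gaussianReal 0 (v - t)) = 1 := by
  rcases lt_or_ge t v with h | h
  · rw [← setLIntegral_univ, ← withDensity_apply _ MeasurableSet.univ,
      gaussianReal_withDensity_llrTerm_right ht h, measure_univ]
  · rw [tsub_eq_zero_of_le h, gaussianReal_zero_var, lintegral_dirac, llrTerm_of_le h]
    simp

/-- The dual feasibility condition of the rate-distortion problem: it holds at every `y`, not only
at those charged by the optimal output law. -/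
theorem lintegral_exp_llrTerm_left_le_one {t v : ℝ≥0} (ht : 0 < t) (y : ℝ) :
    ∫⁻ x, ENNReal.ofReal (Real.exp (llrTerm t v x y)) ∂(gaussianReal 0 v) ≤ 1 := by
  rcases lt_or_ge t v with h | h
  · rw [← setLIntegral_univ, ← withDensity_apply _ MeasurableSet.univ,
      gaussianReal_withDensity_llrTerm_left ht h, measure_univ]
  · have ht' : (0 : ℝ) < t := by exact_mod_cast ht
    have hm := congrFun (mgf_id_gaussianReal (μ := 0) (v := v)) (y / t)
    simp only [mgf, id] at hm
    simp_rw [llrTerm_of_le h, Real.exp_sub, div_eq_mul_inv (Real.exp _)]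
    rw [← ofReal_integral_eq_lintegral_ofReal
      ((integrable_exp_mul_gaussianReal (y / t)).mul_const _)
      (Filter.Eventually.of_forall fun _ => by positivity), integral_mul_const, hm]
    rw [← ENNReal.ofReal_one, ← Real.exp_neg, ← Real.exp_add]
    refine ENNReal.ofReal_le_ofReal (Real.exp_le_one_iff.2 ?_)
    have h' : (v : ℝ) ≤ t := by exact_mod_cast h
    have : 0 * (y / t) + v * (y / t) ^ 2 / 2 + -(y ^ 2 / (2 * t)) =
      y ^ 2 / (2 * t ^ 2) * (v - t) := by field_simp; ring
    rw [this]
    exact mul_nonpos_of_nonneg_of_nonpos (by positivity) (by linarith)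

theorem lintegral_sq_sub_gaussianReal (m : ℝ) (v : ℝ≥0) :
    ∫⁻ x, ENNReal.ofReal ((x - m) ^ 2) ∂(gaussianReal m v) = v := by
  have h := variance_fun_id_gaussianReal (μ := m) (v := v)
  rw [variance_eq_integral (by fun_prop), integral_id_gaussianReal] at h
  have hi : Integrable (fun x => (x - m) ^ 2) (gaussianReal m v) :=
    ((memLp_id_gaussianReal 2).sub (memLp_const m)).integrable_sq
  rw [← ofReal_integral_eq_lintegral_ofReal hi (Filter.Eventually.of_forall fun _ => by positivity),
    h, ENNReal.ofReal_coe_nnreal]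

/-- For almost every output `y` of the optimal test channel, `x ↦ exp (llrTerm t v x y)` is a
probability density with respect to `N(0, v)`, with mean squared deviation `min v t` from `y`. -/
theorem ae_lintegral_exp_llrTerm_left {t v : ℝ≥0} (ht : 0 < t) :
    ∀ᵐ y ∂(gaussianReal 0 (v - t)),
      ∫⁻ x, ENNReal.ofReal (Real.exp (llrTerm t v x y)) ∂(gaussianReal 0 v) = 1 ∧
      ∫⁻ x, ENNReal.ofReal (Real.exp (llrTerm t v x y)) * ENNReal.ofReal ((x - y) ^ 2)
        ∂(gaussianReal 0 v) = (min v t : ℝ≥0) := by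
  rcases lt_or_ge t v with h | h
  · refine Filter.Eventually.of_forall fun y => ⟨?_, ?_⟩
    · rw [← setLIntegral_univ, ← withDensity_apply _ MeasurableSet.univ,
        gaussianReal_withDensity_llrTerm_left ht h, measure_univ]
    · have hm : Measurable fun x => ENNReal.ofReal (Real.exp (llrTerm t v x y)) := by
        unfold llrTerm; fun_prop
      have := lintegral_withDensity_eq_lintegral_mul (gaussianReal 0 v) hm
        (g := fun x => ENNReal.ofReal ((x - y) ^ 2)) (by fun_prop)
      simp only [Pi.mul_apply] at this
      rw [← this, gaussianReal_withDensity_llrTerm_left ht h, lintegral_sq_sub_gaussianReal,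
        min_eq_right h.le]
  · rw [tsub_eq_zero_of_le h, gaussianReal_zero_var, ae_dirac_eq]
    change _ ∧ _
    simp_rw [llrTerm_of_le h]
    have := lintegral_sq_sub_gaussianReal 0 v
    simp_all

/-! ### Kullback-Leibler divergence and exponential densities -/

/-- The variational (Donsker-Varadhan) lower bound on the Kullback-Leibler divergence, for a test
function whose exponential moment under the reference measure is at most one. -/
theorem ofReal_integral_le_klDiv {α : Type*} [MeasurableSpace α] {P Q : Measure α}
    [IsProbabilityMeasure P] [IsProbabilityMeasure Q] {f : α → ℝ} (hf : Measurable f)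
    (hfP : Integrable f P) (hfQ : ∫⁻ a, ENNReal.ofReal (Real.exp (f a)) ∂Q ≤ 1) :
    ENNReal.ofReal (∫ a, f a ∂P) ≤ klDiv P Q := by
  by_cases htop : klDiv P Q = ∞
  · simp [htop]
  obtain ⟨hac, hint⟩ := klDiv_ne_top_iff.1 htop
  rw [← ENNReal.ofReal_toReal htop, toReal_klDiv_eq_integral_klFun hac]
  refine ENNReal.ofReal_le_ofReal ?_
  have hexp : Integrable (fun a => Real.exp (f a)) Q :=
    (lintegral_ofReal_ne_top_iff_integrable (by fun_prop)
      (Filter.Eventually.of_forall fun _ => by positivity)).1 (hfQ.trans_lt ENNReal.one_lt_top).ne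
  have hexp1 : ∫ a, Real.exp (f a) ∂Q ≤ 1 := by
    rw [integral_eq_lintegral_of_nonneg_ae (Filter.Eventually.of_forall fun _ => by positivity)
      (by fun_prop)]
    exact ENNReal.toReal_mono ENNReal.one_ne_top hfQ
  have hr : Integrable (fun a => (P.rnDeriv Q a).toReal * f a) Q :=
    (integrable_rnDeriv_smul_iff hac).2 hfP
  have hr' : ∫ a, (P.rnDeriv Q a).toReal * f a ∂Q = ∫ a, f a ∂P := integral_rnDeriv_smul hac
  have hkl : Integrable (fun a => klFun (P.rnDeriv Q a).toReal) Q :=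
    (integrable_klFun_rnDeriv_iff hac).2 hint
  have hsub : Integrable (fun a => 1 - Real.exp (f a)) Q := (integrable_const 1).sub hexp
  have hmono : ∫ a, ((P.rnDeriv Q a).toReal * f a + (1 - Real.exp (f a))) ∂Q ≤
      ∫ a, klFun (P.rnDeriv Q a).toReal ∂Q := by
    refine integral_mono (hr.add hsub) hkl fun a => ?_
    rw [klFun_apply]
    rcases (ENNReal.toReal_nonneg (a := P.rnDeriv Q a)).eq_or_lt with h | h
    · have := Real.exp_pos (f a)
      simp only [← h]
      linarith
    · set r := (P.rnDeriv Q a).toReal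
      -- the convex conjugate of `klFun` at `f a`, from `s + 1 ≤ exp s` at `s = f a - log r`
      have h1 := Real.add_one_le_exp (f a - Real.log r)
      rw [Real.exp_sub, Real.exp_log h, le_div_iff₀ h] at h1
      linarith
  rw [integral_add hr hsub, hr',
    integral_sub (integrable_const 1) hexp] at hmono
  simp only [integral_const, probReal_univ, smul_eq_mul, one_mul] at hmono
  linarith

theorem klDiv_withDensity_exp {α : Type*} [MeasurableSpace α] {Q : Measure α}
    [IsProbabilityMeasure Q] {f : α → ℝ} (hf : Measurable f)
    [IsProbabilityMeasure (Q.withDensity fun a => ENNReal.ofReal (Real.exp (f a)))]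
    (hfP : Integrable f (Q.withDensity fun a => ENNReal.ofReal (Real.exp (f a)))) :
    klDiv (Q.withDensity fun a => ENNReal.ofReal (Real.exp (f a))) Q =
      ENNReal.ofReal (∫ a, f a ∂(Q.withDensity fun a => ENNReal.ofReal (Real.exp (f a)))) := by
  set P := Q.withDensity fun a => ENNReal.ofReal (Real.exp (f a)) with hP
  have hac : P ≪ Q := withDensity_absolutelyContinuous _ _
  have hllr : llr P Q =ᵐ[P] f := by
    filter_upwards [hac.ae_le (Measure.rnDeriv_withDensity Q
      (f := fun a => ENNReal.ofReal (Real.exp (f a))) (by fun_prop))] with a ha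
    rw [llr, ha, ENNReal.toReal_ofReal (Real.exp_pos _).le, Real.log_exp]
  rw [klDiv_of_ac_of_integrable hac (hfP.congr hllr.symm), integral_congr_ae hllr]
  simp

theorem lintegral_pi_prod {ι : Type*} [Fintype ι] {E : ι → Type*} [∀ i, MeasurableSpace (E i)]
    (μ : ∀ i, Measure (E i)) [∀ i, IsProbabilityMeasure (μ i)] {g : ∀ i, E i → ℝ≥0∞}
    (hg : ∀ i, Measurable (g i)) :
    ∫⁻ x, ∏ i, g i (x i) ∂(Measure.pi μ) = ∏ i, ∫⁻ x, g i x ∂(μ i) := by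
  refine (lintegral_prod_eq_prod_lintegral_of_indepFun Finset.univ
    (fun i (x : ∀ i, E i) => g i (x i)) (iIndepFun_pi fun i => (hg i).aemeasurable)
    fun i => (hg i).comp (measurable_pi_apply i)).trans ?_
  exact Finset.prod_congr rfl fun i _ => (measurePreserving_eval μ i).lintegral_comp (hg i)

/-! ### Independent Gaussian components -/

section Vector

variable {ι : Type*} [Fintype ι]

/-- The log-likelihood ratio of the optimal test channel for independent scalar Gaussian sources of
variances `v i`, at the common water level `t`. -/
def llrSum (t : ℝ≥0) (v : ι → ℝ≥0) (z w : ι → ℝ) : ℝ := ∑ i, llrTerm t (v i) (z i) (w i)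

theorem ofReal_exp_llrSum (t : ℝ≥0) (v : ι → ℝ≥0) (z w : ι → ℝ) :
    ENNReal.ofReal (Real.exp (llrSum t v z w)) =
      ∏ i, ENNReal.ofReal (Real.exp (llrTerm t (v i) (z i) (w i))) := by
  rw [llrSum, Real.exp_sum, ENNReal.ofReal_prod_of_nonneg fun _ _ => (Real.exp_pos _).le]

theorem lintegral_exp_llrSum_left_le_one {t : ℝ≥0} (ht : 0 < t) (v : ι → ℝ≥0) (w : ι → ℝ) :
    ∫⁻ z, ENNReal.ofReal (Real.exp (llrSum t v z w))
      ∂(Measure.pi fun i => gaussianReal 0 (v i)) ≤ 1 := by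
  simp_rw [ofReal_exp_llrSum]
  rw [lintegral_pi_prod _ (g := fun i x => ENNReal.ofReal (Real.exp (llrTerm t (v i) x (w i))))
    fun i => by unfold llrTerm; fun_prop]
  exact Finset.prod_le_one' fun i _ => lintegral_exp_llrTerm_left_le_one ht _

theorem lintegral_exp_llrSum_right {t : ℝ≥0} (ht : 0 < t) (v : ι → ℝ≥0) (z : ι → ℝ) :
    ∫⁻ w, ENNReal.ofReal (Real.exp (llrSum t v z w))
      ∂(Measure.pi fun i => gaussianReal 0 (v i - t)) = 1 := by
  simp_rw [ofReal_exp_llrSum]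
  rw [lintegral_pi_prod _ (g := fun i y => ENNReal.ofReal (Real.exp (llrTerm t (v i) (z i) y)))
    fun i => by unfold llrTerm; fun_prop]
  exact Finset.prod_eq_one fun i _ => lintegral_exp_llrTerm_right ht _

theorem ae_lintegral_exp_llrSum_left {t : ℝ≥0} (ht : 0 < t) (v : ι → ℝ≥0) :
    ∀ᵐ w ∂(Measure.pi fun i => gaussianReal 0 (v i - t)),
      ∫⁻ z, ENNReal.ofReal (Real.exp (llrSum t v z w))
        ∂(Measure.pi fun i => gaussianReal 0 (v i)) = 1 ∧
      ∫⁻ z, ENNReal.ofReal (Real.exp (llrSum t v z w)) * ENNReal.ofReal (∑ i, (z i - w i) ^ 2)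
        ∂(Measure.pi fun i => gaussianReal 0 (v i)) = ∑ i, ((min (v i) t : ℝ≥0) : ℝ≥0∞) := by
  classical
  have hae : ∀ᵐ w ∂(Measure.pi fun i => gaussianReal 0 (v i - t)), ∀ i,
      ∫⁻ x, ENNReal.ofReal (Real.exp (llrTerm t (v i) x (w i))) ∂(gaussianReal 0 (v i)) = 1 ∧
      ∫⁻ x, ENNReal.ofReal (Real.exp (llrTerm t (v i) x (w i))) * ENNReal.ofReal ((x - w i) ^ 2)
        ∂(gaussianReal 0 (v i)) = (min (v i) t : ℝ≥0) :=
    ae_all_iff.2 fun i =>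
      (Measure.quasiMeasurePreserving_eval (fun i => gaussianReal 0 (v i - t)) i).ae
        (ae_lintegral_exp_llrTerm_left ht)
  filter_upwards [hae] with w hw
  simp_rw [ofReal_exp_llrSum, ENNReal.ofReal_sum_of_nonneg fun i _ => sq_nonneg _, Finset.mul_sum]
  have hmeas : ∀ i, Measurable fun x : ℝ =>
      ENNReal.ofReal (Real.exp (llrTerm t (v i) x (w i))) := fun i => by
    unfold llrTerm; fun_prop
  constructor
  · rw [lintegral_pi_prod _ hmeas]
    exact Finset.prod_eq_one fun i _ => (hw i).1
  · rw [lintegral_finsetSum Finset.univ (f := fun i (z : ι → ℝ) =>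
      (∏ j, ENNReal.ofReal (Real.exp (llrTerm t (v j) (z j) (w j)))) *
        ENNReal.ofReal ((z i - w i) ^ 2)) fun i _ => by unfold llrTerm; fun_prop]
    refine Finset.sum_congr rfl fun i _ => ?_
    -- the factor `(z i - w i) ^ 2` is absorbed into the `i`-th factor of the product density
    have hsplit : ∀ z : ι → ℝ, (∏ j, ENNReal.ofReal (Real.exp (llrTerm t (v j) (z j) (w j)))) *
        ENNReal.ofReal ((z i - w i) ^ 2) =
        ∏ j, (ENNReal.ofReal (Real.exp (llrTerm t (v j) (z j) (w j))) *
          if j = i then ENNReal.ofReal ((z j - w j) ^ 2) else 1) := fun z => by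
      rw [Finset.prod_mul_distrib, Finset.prod_ite_eq' Finset.univ i]
      simp
    simp_rw [hsplit]
    rw [lintegral_pi_prod _
      (g := fun j x => ENNReal.ofReal (Real.exp (llrTerm t (v j) x (w j))) *
          if j = i then ENNReal.ofReal ((x - w j) ^ 2) else 1)
      fun j => (hmeas j).mul (by split_ifs <;> fun_prop)]
    rw [Finset.prod_eq_single i]
    · simpa using (hw i).2
    · intro j _ hj
      simpa [hj] using (hw j).1
    · simp

end Vector

/-! ### The rate-distortion function of a Gaussian vector -/

/-- `T` is a Euclidean isometric chart of `σ → ℝ`, with measurable right inverse `T'`, in which the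
law `μ` is a product of centred Gaussian laws of variances `v i`. The coordinates are indexed by a
type `ι` of their own, so that the chart of a field can be indexed by pairs (region, eigenvalue). -/
structure IsGaussianChart {σ ι : Type*} [Fintype σ] [Fintype ι] (μ : Measure (σ → ℝ))
    (v : ι → ℝ≥0) (T : (σ → ℝ) → ι → ℝ) (T' : (ι → ℝ) → σ → ℝ) : Prop where
  measurable : Measurable T
  measurable_inv : Measurable T'
  right_inv : ∀ w, T (T' w) = w
  isometry : ∀ x y, ∑ i, (T x i - T y i) ^ 2 = ∑ s, (x s - y s) ^ 2
  map_eq : μ.map T = Measure.pi fun i => gaussianReal 0 (v i)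

namespace IsGaussianChart

variable {σ ι : Type*} [Fintype σ] [Fintype ι] {μ : Measure (σ → ℝ)}
    {v : ι → ℝ≥0} {T : (σ → ℝ) → ι → ℝ} {T' : (ι → ℝ) → σ → ℝ}

theorem integrable_sq (h : IsGaussianChart μ v T T') (i : ι) :
    Integrable (fun x => T x i ^ 2) μ ∧ ∫ x, T x i ^ 2 ∂μ = v i := by
  have hmp : MeasurePreserving (fun x => T x i) μ (gaussianReal 0 (v i)) :=
    (measurePreserving_eval (fun i => gaussianReal 0 (v i)) i).comp ⟨h.measurable, h.map_eq⟩
  have hi : Integrable (fun x : ℝ => x ^ 2) (gaussianReal 0 (v i)) :=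
    (memLp_id_gaussianReal 2).integrable_sq
  refine ⟨hmp.integrable_comp_of_integrable hi, ?_⟩
  have hv := variance_fun_id_gaussianReal (μ := 0) (v := v i)
  rw [variance_eq_integral (by fun_prop), integral_id_gaussianReal] at hv
  simp only [sub_zero] at hv
  rw [← hv, ← hmp.map_eq, integral_map hmp.aemeasurable (by fun_prop)]

theorem measurable_llrSum (h : IsGaussianChart μ v T T') (t : ℝ≥0) :
    Measurable fun p : (σ → ℝ) × (σ → ℝ) => llrSum t v (T p.1) (T p.2) := by
  have := h.measurable
  unfold llrSum llrTerm
  fun_prop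

/-- The expected log-likelihood ratio depends on the joint law of source and reproduction only
through the expected distortion. -/
theorem integral_llrSum [Nonempty σ] (h : IsGaussianChart μ v T T') {t : ℝ≥0} (ht : 0 < t)
    {P : Measure ((σ → ℝ) × (σ → ℝ))} [IsProbabilityMeasure P] (hP : P.fst = μ)
    (hmse : Integrable (fun p => mse p.1 p.2) P) :
    Integrable (fun p => llrSum t v (T p.1) (T p.2)) P ∧
      ∫ p, llrSum t v (T p.1) (T p.2) ∂P =
        (1 / 2) * ∑ i, max (Real.log (v i / t)) 0 +
          (1 / (2 * t)) * (∑ i, min (v i : ℝ) t - Fintype.card σ * ∫ p, mse p.1 p.2 ∂P) := by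
  have ht' : (0 : ℝ) < t := by exact_mod_cast ht
  have hn : (0 : ℝ) < Fintype.card σ := by exact_mod_cast Fintype.card_pos
  have hmp : MeasurePreserving Prod.fst P μ := ⟨measurable_fst, hP⟩
  have heq : ∀ p : (σ → ℝ) × (σ → ℝ), llrSum t v (T p.1) (T p.2) =
      ((1 / 2) * ∑ i, max (Real.log (v i / t)) 0 -
        (Fintype.card σ / (2 * t)) * mse p.1 p.2) +
          ∑ i, T p.1 i ^ 2 / (2 * max (v i : ℝ) t) := fun p => by
    rw [mse, ← h.isometry]
    simp only [llrSum, llrTerm, Finset.sum_add_distrib, Finset.sum_sub_distrib, ← Finset.sum_div]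
    field_simp
  have hsq : ∀ i, Integrable
      (fun p : (σ → ℝ) × (σ → ℝ) => T p.1 i ^ 2 / (2 * max (v i : ℝ) t)) P := fun i =>
    (hmp.integrable_comp_of_integrable (h.integrable_sq i).1).div_const _
  have hsum := integrable_finsetSum Finset.univ fun i _ => hsq i
  have hfirst : Integrable (fun p : (σ → ℝ) × (σ → ℝ) =>
      (1 / 2) * ∑ i, max (Real.log (v i / t)) 0 - (Fintype.card σ / (2 * t)) * mse p.1 p.2) P :=
    (integrable_const _).sub (hmse.const_mul _)
  simp_rw [heq]
  refine ⟨hfirst.add hsum, ?_⟩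
  rw [integral_add hfirst hsum, integral_sub (integrable_const _) (hmse.const_mul _),
    integral_const_mul (Fintype.card σ / (2 * t) : ℝ), integral_finsetSum _ fun i _ => hsq i]
  have hmin : ∀ i, ∫ p : (σ → ℝ) × (σ → ℝ), T p.1 i ^ 2 / (2 * max (v i : ℝ) t) ∂P =
      (1 / (2 * t)) * min (v i : ℝ) t := fun i => by
    have hfst : ∫ p : (σ → ℝ) × (σ → ℝ), T p.1 i ^ 2 ∂P = v i := by
      have hm : Measurable fun x => T x i ^ 2 :=
        ((measurable_pi_apply i).comp h.measurable).pow_const 2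
      rw [← (h.integrable_sq i).2, ← hmp.map_eq,
        integral_map hmp.aemeasurable hm.aestronglyMeasurable]
    rw [integral_div, hfst]
    -- `v / max v t = min v t / t`
    have hmax : 0 < max (v i : ℝ) t := lt_max_of_lt_right ht'
    have := min_mul_max (v i : ℝ) t
    field_simp
    linarith
  simp_rw [hmin, ← Finset.mul_sum]
  simp only [integral_const, probReal_univ, smul_eq_mul, one_mul]
  ring

/-- Converse part of reverse water-filling, in Lagrangian form: for every water level `t`, the
affine function of slope `-1 / (2 * t)` through the point of the water-filling curve at level `t`
lies below the rate-distortion function. -/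
theorem le_rateDistortion [Nonempty σ] [IsProbabilityMeasure μ]
    (h : IsGaussianChart μ v T T') {t : ℝ≥0} (ht : 0 < t) (D : ℝ) :
    ENNReal.ofReal ((1 / (2 * (Fintype.card σ : ℝ))) * ∑ i, max (Real.log (v i / t)) 0 +
        (1 / (2 * t)) * ((1 / (Fintype.card σ : ℝ)) * ∑ i, min (v i : ℝ) t - D)) ≤
      rateDistortion μ D := by
  refine le_iInf fun κ => le_iInf fun _ => le_iInf fun hκ => ?_
  have ht' : (0 : ℝ) < t := by exact_mod_cast ht
  have hn : (0 : ℝ) < Fintype.card σ := by exact_mod_cast Fintype.card_pos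
  have hmeas := h.measurable_llrSum t
  obtain ⟨hi, hval⟩ := h.integral_llrSum ht (Measure.fst_compProd μ κ) hκ.1
  have hkl : ENNReal.ofReal (∫ p, llrSum t v (T p.1) (T p.2) ∂(μ ⊗ₘ κ)) ≤ mutualInfo μ κ := by
    refine ofReal_integral_le_klDiv hmeas hi ?_
    rw [lintegral_prod_symm _ hmeas.exp.ennreal_ofReal.aemeasurable]
    calc _ ≤ ∫⁻ _, 1 ∂(κ ∘ₘ μ) := lintegral_mono fun y => by
          have := lintegral_exp_llrSum_left_le_one ht v (T y)
          rwa [← h.map_eq, lintegral_map (by unfold llrSum llrTerm; fun_prop) h.measurable] at this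
      _ = 1 := by simp
  calc _ ≤ ENNReal.ofReal ((Fintype.card σ : ℝ)⁻¹ *
        ∫ p, llrSum t v (T p.1) (T p.2) ∂(μ ⊗ₘ κ)) := by
        refine ENNReal.ofReal_le_ofReal ?_
        rw [hval]
        have := mul_le_mul_of_nonneg_left hκ.2 (show 0 ≤ 1 / (2 * (t : ℝ)) by positivity)
        calc _ ≤ (1 / (2 * (Fintype.card σ : ℝ))) * ∑ i, max (Real.log (v i / t)) 0 +
              (1 / (2 * t)) * ((1 / (Fintype.card σ : ℝ)) * ∑ i, min (v i : ℝ) t) -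
              (1 / (2 * t)) * ∫ p, mse p.1 p.2 ∂(μ ⊗ₘ κ) := by linarith
          _ = _ := by field_simp; ring
    _ = (Fintype.card σ : ℝ≥0∞)⁻¹ * ENNReal.ofReal
        (∫ p, llrSum t v (T p.1) (T p.2) ∂(μ ⊗ₘ κ)) := by
        rw [ENNReal.ofReal_mul (by positivity), ENNReal.ofReal_inv_of_pos hn,
          ENNReal.ofReal_natCast]
    _ ≤ _ := by gcongr

/-- Achievability part of reverse water-filling: the optimal test channel at water level `t` meets
the distortion and has the claimed rate. -/
theorem rateDistortion_le [Nonempty σ] [IsProbabilityMeasure μ]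
    (h : IsGaussianChart μ v T T') {t : ℝ≥0} (ht : 0 < t) :
    rateDistortion μ ((1 / (Fintype.card σ : ℝ)) * ∑ i, min (v i : ℝ) t) ≤
      ENNReal.ofReal ((1 / (2 * (Fintype.card σ : ℝ))) * ∑ i, max (Real.log (v i / t)) 0) := by
  have ht' : (0 : ℝ) < t := by exact_mod_cast ht
  have hn : (0 : ℝ) < Fintype.card σ := by exact_mod_cast Fintype.card_pos
  set f : (σ → ℝ) → (σ → ℝ) → ℝ≥0∞ :=
    fun x y => ENNReal.ofReal (Real.exp (llrSum t v (T x) (T y))) with hf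
  have hmeas := h.measurable_llrSum t
  have hfm : Measurable fun p : (σ → ℝ) × (σ → ℝ) => f p.1 p.2 :=
    hmeas.exp.ennreal_ofReal
  set ν : Measure (σ → ℝ) := (Measure.pi fun i => gaussianReal 0 (v i - t)).map T' with hν
  have : IsProbabilityMeasure ν :=
    Measure.isProbabilityMeasure_map h.measurable_inv.aemeasurable
  have hνT : ν.map T = Measure.pi fun i => gaussianReal 0 (v i - t) := by
    rw [hν, Measure.map_map h.measurable h.measurable_inv]
    convert Measure.map_id
    ext1 w
    exact h.right_inv w
  have hright : ∀ x, ∫⁻ y, f x y ∂ν = 1 := fun x => by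
    have := lintegral_exp_llrSum_right ht v (T x)
    rwa [← hνT, lintegral_map (by unfold llrSum llrTerm; fun_prop) h.measurable] at this
  have hleft : ∀ᵐ y ∂ν, ∫⁻ x, f x y ∂μ = 1 ∧
      ∫⁻ x, f x y * ENNReal.ofReal (∑ s, (x s - y s) ^ 2) ∂μ =
        ∑ i, ((min (v i) t : ℝ≥0) : ℝ≥0∞) := by
    have := ae_lintegral_exp_llrSum_left ht v
    rw [← hνT] at this
    filter_upwards [ae_of_ae_map h.measurable.aemeasurable this] with y hy
    rw [← h.map_eq, lintegral_map (by unfold llrSum llrTerm; fun_prop) h.measurable,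
      lintegral_map (by unfold llrSum llrTerm; fun_prop) h.measurable] at hy
    simpa only [h.isometry] using hy
  -- the optimal test channel has density `f x` with respect to the output law `ν`
  set κ : Kernel (σ → ℝ) (σ → ℝ) := (Kernel.const _ ν).withDensity f with hκ
  have hκm : IsMarkovKernel κ := ⟨fun x => ⟨by
    rw [hκ, Kernel.withDensity_apply _ hfm, withDensity_apply _ MeasurableSet.univ,
      setLIntegral_univ, Kernel.const_apply, hright]⟩⟩
  have hjoint : μ ⊗ₘ κ = (μ.prod ν).withDensity fun p => f p.1 p.2 := by
    rw [hκ, Measure.compProd_withDensity hfm, Measure.compProd_const]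
  -- the output law of `κ` is indeed `ν`
  have hsnd : κ ∘ₘ μ = ν := by
    rw [← Measure.snd_compProd, hjoint]
    ext s hs
    rw [Measure.snd_apply hs, withDensity_apply _ (measurable_snd hs),
      ← lintegral_indicator (measurable_snd hs), lintegral_prod_symm _
        ((hfm.indicator (measurable_snd hs)).aemeasurable)]
    calc _ = ∫⁻ y, s.indicator 1 y ∂ν := by
          refine lintegral_congr_ae ?_
          filter_upwards [hleft] with y hy
          by_cases hys : y ∈ s
          · simp [Set.indicator, hys, hy.1]
          · simp [Set.indicator, hys]
      _ = _ := by rw [lintegral_indicator_one hs]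
  have hmse_meas : Measurable fun p : (σ → ℝ) × (σ → ℝ) => mse p.1 p.2 := by
    unfold mse; fun_prop
  have hmse_nonneg : ∀ p : (σ → ℝ) × (σ → ℝ), 0 ≤ mse p.1 p.2 := fun p => by
    unfold mse; positivity
  have hdist : ∫⁻ p, ENNReal.ofReal (mse p.1 p.2) ∂(μ ⊗ₘ κ) =
      ENNReal.ofReal ((1 / (Fintype.card σ : ℝ)) * ∑ i, min (v i : ℝ) t) := by
    rw [hjoint, lintegral_withDensity_eq_lintegral_mul _ hfm hmse_meas.ennreal_ofReal,
      lintegral_prod_symm _ (hfm.mul hmse_meas.ennreal_ofReal).aemeasurable]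
    have hc : ENNReal.ofReal (1 / (Fintype.card σ : ℝ)) * ∑ i, ((min (v i) t : ℝ≥0) : ℝ≥0∞) =
        ENNReal.ofReal ((1 / (Fintype.card σ : ℝ)) * ∑ i, min (v i : ℝ) t) := by
      rw [ENNReal.ofReal_mul (by positivity)]
      congr 1
      rw [ENNReal.ofReal_sum_of_nonneg fun i _ => by positivity]
      refine Finset.sum_congr rfl fun i _ => ?_
      rw [← NNReal.coe_min, ENNReal.ofReal_coe_nnreal]
    rw [← hc]
    calc _ = ∫⁻ _, ENNReal.ofReal (1 / (Fintype.card σ : ℝ)) *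
          ∑ i, ((min (v i) t : ℝ≥0) : ℝ≥0∞) ∂ν := by
          refine lintegral_congr_ae ?_
          filter_upwards [hleft] with y hy
          rw [← hy.2, ← lintegral_const_mul' _ _ ENNReal.ofReal_ne_top]
          refine lintegral_congr fun x => ?_
          simp only [Pi.mul_apply, mse]
          rw [ENNReal.ofReal_mul (by positivity)]
          ring
      _ = _ := by simp
  have hmse : Integrable (fun p : (σ → ℝ) × (σ → ℝ) => mse p.1 p.2) (μ ⊗ₘ κ) :=
    (lintegral_ofReal_ne_top_iff_integrable hmse_meas.aestronglyMeasurable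
      (Filter.Eventually.of_forall hmse_nonneg)).1 (by rw [hdist]; exact ENNReal.ofReal_ne_top)
  have hmse_val : ∫ p, mse p.1 p.2 ∂(μ ⊗ₘ κ) =
      (1 / (Fintype.card σ : ℝ)) * ∑ i, min (v i : ℝ) t := by
    rw [integral_eq_lintegral_of_nonneg_ae (Filter.Eventually.of_forall hmse_nonneg)
      hmse_meas.aestronglyMeasurable, hdist, ENNReal.toReal_ofReal (by positivity)]
  obtain ⟨hi, hval⟩ := h.integral_llrSum ht (Measure.fst_compProd μ κ) hmse
  have hinfo : mutualInfo μ κ =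
      ENNReal.ofReal ((1 / 2) * ∑ i, max (Real.log (v i / t)) 0) := by
    have hP : IsProbabilityMeasure (μ ⊗ₘ κ) := inferInstance
    rw [mutualInfo, hsnd]
    rw [hjoint] at hi hP hval ⊢
    rw [klDiv_withDensity_exp hmeas hi, hval, ← hjoint, hmse_val]
    congr 1
    field_simp
    ring
  refine (iInf_le_of_le κ <| iInf_le_of_le hκm <| iInf_le_of_le ⟨hmse, hmse_val.le⟩ le_rfl).trans
    (le_of_eq ?_)
  rw [hinfo, ← ENNReal.ofReal_natCast, ← ENNReal.ofReal_inv_of_pos hn,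
    ← ENNReal.ofReal_mul (by positivity)]
  congr 1
  field_simp

end IsGaussianChart

/-! ### Diagonalization of the Gaussian field -/

/-- An orthogonal matrix that diagonalizes the covariance of a Gaussian vector decorrelates it, and
uncorrelated jointly Gaussian coordinates are independent. -/
theorem isGaussianChart_of_mulVec {Ω σ ι : Type*} [MeasurableSpace Ω] [Fintype σ] [Fintype ι]
    [DecidableEq σ] [DecidableEq ι] {P : Measure Ω} [IsProbabilityMeasure P] {X : Ω → σ → ℝ}
    (hX : HasGaussianLaw X P) {U : Matrix ι σ ℝ} (hU : Uᵀ * U = 1) (hU' : U * Uᵀ = 1) {v : ι → ℝ}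
    (hv : U * (Matrix.of fun s t => cov[fun ω => X ω s, fun ω => X ω t; P]) * Uᵀ =
      Matrix.diagonal v) :
    IsGaussianChart (P.map X) (fun i => (v i).toNNReal)
      (fun x => U *ᵥ (x - fun s => ∫ ω, X ω s ∂P))
      (fun w => Uᵀ *ᵥ w + fun s => ∫ ω, X ω s ∂P) := by
  set m : σ → ℝ := fun s => ∫ ω, X ω s ∂P with hm
  have hT : Measurable fun x : σ → ℝ => U *ᵥ (x - m) := by
    unfold Matrix.mulVec dotProduct
    fun_prop
  refine ⟨hT, by unfold Matrix.mulVec dotProduct; fun_prop, fun w => ?_, fun x y => ?_, ?_⟩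
  · rw [add_sub_cancel_right, Matrix.mulVec_mulVec, hU', Matrix.one_mulVec]
  · have h : ∀ z : σ → ℝ, (U *ᵥ z) ⬝ᵥ (U *ᵥ z) = z ⬝ᵥ z := fun z => by
      rw [Matrix.dotProduct_mulVec, Matrix.vecMul_mulVec, hU, Matrix.vecMul_one]
    have := h (x - y)
    rw [show x - y = (x - m) - (y - m) by abel, Matrix.mulVec_sub] at this
    simpa [dotProduct, pow_two] using this
  · have hL2 : ∀ s, MemLp (fun ω => X ω s) 2 P := fun s => (hX.eval s).memLp_two
    have hY : HasGaussianLaw (fun ω i => (U *ᵥ X ω) i) P :=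
      hX.map_fun (LinearMap.toContinuousLinearMap (Matrix.mulVecLin U))
    have hcov : ∀ i j, cov[fun ω => (U *ᵥ X ω) i, fun ω => (U *ᵥ X ω) j; P] =
        Matrix.diagonal v i j := fun i j => by
      rw [← hv]
      simp only [Matrix.mulVec, dotProduct]
      rw [covariance_fun_sum_fun_sum (fun s => (hL2 s).const_mul _) (fun s => (hL2 s).const_mul _)]
      simp only [covariance_const_mul_left, covariance_const_mul_right, Matrix.mul_apply,
        Matrix.transpose_apply, Matrix.of_apply, Finset.sum_mul]
      rw [Finset.sum_comm]
      refine Finset.sum_congr rfl fun s _ => Finset.sum_congr rfl fun t _ => by ring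
    have hind : iIndepFun (fun i ω => (U *ᵥ X ω) i) P :=
      hY.iIndepFun_of_covariance_eq_zero fun i j hij => by
        rw [hcov, Matrix.diagonal_apply_ne _ hij]
    have hind' : iIndepFun (fun i ω => (U *ᵥ X ω) i - (U *ᵥ m) i) P :=
      hind.comp (fun i y => y - (U *ᵥ m) i) fun i => by fun_prop
    have hae : ∀ i, AEMeasurable (fun ω => (U *ᵥ X ω) i) P := fun i => (hY.eval i).aemeasurable
    rw [AEMeasurable.map_map_of_aemeasurable hT.aemeasurable hX.aemeasurable]
    have hcomp : (fun x => U *ᵥ (x - m)) ∘ X = fun ω i => (U *ᵥ X ω) i - (U *ᵥ m) i := by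
      ext ω i
      simp [Matrix.mulVec_sub]
    rw [hcomp, hind'.map_fun_eq_pi_map fun i => (hae i).sub_const _]
    congr 1
    ext1 i
    have hmean : ∫ ω, (U *ᵥ X ω) i ∂P = (U *ᵥ m) i := by
      simp only [Matrix.mulVec, dotProduct, hm]
      rw [integral_finsetSum _ fun s _ => ((hL2 s).integrable one_le_two).const_mul _]
      simp_rw [integral_const_mul]
    have hvar : Var[fun ω => (U *ᵥ X ω) i; P] = v i := by
      rw [← covariance_self (hae i), hcov, Matrix.diagonal_apply_eq]
    have hlaw := (hY.eval i).map_eq_gaussianReal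
    rw [hmean, hvar] at hlaw
    have := gaussianReal_sub_const ⟨hae i, hlaw⟩ ((U *ᵥ m) i)
    rw [sub_self] at this
    exact this.map_eq

theorem star_eigenvectorUnitary_mul_mul {n : Type*} [Fintype n] [DecidableEq n]
    {A : Matrix n n ℝ} (hA : A.IsHermitian) :
    (hA.eigenvectorUnitary : Matrix n n ℝ)ᵀ * A * (hA.eigenvectorUnitary : Matrix n n ℝ) =
      Matrix.diagonal hA.eigenvalues := by
  have h := hA.conjStarAlgAut_star_eigenvectorUnitary
  rw [Unitary.conjStarAlgAut_apply] at h
  simpa [Matrix.star_eq_conjTranspose] using h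

section Field

variable {Ω : Type*} [MeasurableSpace Ω] {P : Measure Ω} {d K : ℕ}
  {S : Finset (Fin d → ℤ)} {label : S → Fin K} {X : Ω → S → ℝ}
  {m : Fin K → ℝ} {Γ : Fin K → (Fin d → ℤ) → ℝ}

theorem hasGaussianLaw_regionField (hX : HasGaussianLaw X P) (r : Fin K) :
    HasGaussianLaw (regionField label X r) P :=
  hX.map_fun (ContinuousLinearMap.pi fun s : Region label r =>
    ContinuousLinearMap.proj (R := ℝ) (φ := fun _ : S => ℝ) s.1)

variable [IsProbabilityMeasure P]

theorem exists_isGaussianChart_regionField (hX : HasGaussianLaw X P) (r : Fin K) :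
    ∃ T T', IsGaussianChart (P.map (regionField label X r))
      (fun i => (eig P label X r i).toNNReal) T T' := by
  set U : Matrix (Region label r) (Region label r) ℝ :=
    ↑(covMatrix_isHermitian P label X r).eigenvectorUnitary with hU
  have h1 : Uᵀ * U = 1 :=
    Unitary.coe_star_mul_self (covMatrix_isHermitian P label X r).eigenvectorUnitary
  have h2 : U * Uᵀ = 1 :=
    Unitary.coe_mul_star_self (covMatrix_isHermitian P label X r).eigenvectorUnitary
  exact ⟨_, _, isGaussianChart_of_mulVec (hasGaussianLaw_regionField hX r) (U := Uᵀ)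
    (by simpa using h2) (by simpa using h1) (v := eig P label X r)
    (by
      rw [Matrix.transpose_transpose]
      exact star_eigenvectorUnitary_mul_mul (covMatrix_isHermitian P label X r))⟩

/-- The covariance of the whole field is block diagonal, so the eigenvectors of the regional
covariance matrices, extended by zero, diagonalize it; the eigenvalues of all regions together are
its eigenvalues. -/
theorem exists_isGaussianChart_field (hX : IsPiecewiseGaussian P label X m Γ) :
    ∃ T T', IsGaussianChart (P.map X)
      (fun i : Σ r, Region label r => (eig P label X i.1 i.2).toNNReal) T T' := by
  set U : ∀ r, Matrix (Region label r) (Region label r) ℝ :=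
    fun r => ↑(covMatrix_isHermitian P label X r).eigenvectorUnitary with hU
  have h1 : ∀ r, (U r)ᵀ * U r = 1 := fun r =>
    Unitary.coe_star_mul_self (covMatrix_isHermitian P label X r).eigenvectorUnitary
  have h2 : ∀ r, U r * (U r)ᵀ = 1 := fun r =>
    Unitary.coe_mul_star_self (covMatrix_isHermitian P label X r).eigenvectorUnitary
  let e : (Σ r, Region label r) ≃ S := Equiv.sigmaFiberEquiv label
  have hcov : (Matrix.of fun s t => cov[fun ω => X ω s, fun ω => X ω t; P]) =
      (Matrix.blockDiagonal' fun r => covMatrix P label X r).submatrix e.symm e.symm := by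
    rw [← Matrix.submatrix_id_id (Matrix.of _), ← e.self_comp_symm, ← Matrix.submatrix_submatrix]
    congr 1
    ext ⟨r, s, hs⟩ ⟨r', t, ht⟩
    by_cases hr : r = r'
    · subst hr
      rw [Matrix.blockDiagonal'_apply_eq]
      rfl
    · rw [Matrix.blockDiagonal'_apply_ne _ _ _ hr]
      exact hX.cov_across s t (by rwa [hs, ht])
  refine ⟨_, _, isGaussianChart_of_mulVec hX.gaussian
    (U := (Matrix.blockDiagonal' fun r => (U r)ᵀ).submatrix (Equiv.refl _) e.symm)
    (v := fun i => eig P label X i.1 i.2) ?_ ?_ ?_⟩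
  · rw [Matrix.transpose_submatrix, Matrix.blockDiagonal'_transpose, Matrix.submatrix_mul_equiv,
      ← Matrix.blockDiagonal'_mul]
    simp only [Matrix.transpose_transpose, h2]
    rw [show (fun r => (1 : Matrix (Region label r) (Region label r) ℝ)) = 1 from rfl,
      Matrix.blockDiagonal'_one, Matrix.submatrix_one_equiv]
  · rw [Matrix.transpose_submatrix, Matrix.blockDiagonal'_transpose, Matrix.submatrix_mul_equiv,
      ← Matrix.blockDiagonal'_mul]
    simp only [Matrix.transpose_transpose, h1]
    rw [show (fun r => (1 : Matrix (Region label r) (Region label r) ℝ)) = 1 from rfl,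
      Matrix.blockDiagonal'_one, Matrix.submatrix_one_equiv]
  · rw [hcov, Matrix.transpose_submatrix, Matrix.blockDiagonal'_transpose,
      Matrix.submatrix_mul_equiv, Matrix.submatrix_mul_equiv, ← Matrix.blockDiagonal'_mul,
      ← Matrix.blockDiagonal'_mul, ← Matrix.blockDiagonal'_diagonal]
    simp only [Matrix.transpose_transpose, Equiv.coe_refl, Matrix.submatrix_id_id, hU,
      star_eigenvectorUnitary_mul_mul]
    rfl

end Field

/-! ### Distortion and rate as functions of the water level -/

theorem ofReal_sum_le {ι : Type*} (s : Finset ι) (f : ι → ℝ) :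
    ENNReal.ofReal (∑ i ∈ s, f i) ≤ ∑ i ∈ s, ENNReal.ofReal (f i) :=
  Finset.le_sum_of_subadditive _ ENNReal.ofReal_zero.le (fun _ _ => ENNReal.ofReal_add_le) s f

/-- Tangent inequality between the rate and the distortion of one component of variance `l` at the
water levels `b` and `a`: it comes from `1 - 1 / u ≤ log u` at `u = min l a / min l b`. -/
theorem sub_min_div_le_max_log_sub {l a b : ℝ} (hl : 0 ≤ l) (ha : 0 < a) (hb : 0 < b) :
    (min l a - min l b) / a ≤ max (Real.log (l / b)) 0 - max (Real.log (l / a)) 0 := by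
  have key : ∀ {x y : ℝ}, 0 < x → 0 < y → 1 - y / x ≤ Real.log (x / y) := fun {x y} hx hy => by
    have := Real.one_sub_inv_le_log_of_pos (div_pos hx hy)
    rwa [inv_div] at this
  rcases hl.eq_or_lt with rfl | hl0
  · simp [min_eq_left ha.le, min_eq_left hb.le]
  have hmax : ∀ {c : ℝ}, 0 < c → max (Real.log (l / c)) 0 = Real.log (l / min l c) :=
    fun {c} hc => by
    rcases le_total l c with h | h
    · rw [min_eq_left h, div_self hl0.ne', Real.log_one,
        max_eq_right (Real.log_nonpos (by positivity) ((div_le_one hc).2 h))]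
    · rw [min_eq_right h, max_eq_left (Real.log_nonneg ((one_le_div hc).2 h))]
  have hma : 0 < min l a := lt_min hl0 ha
  have hmb : 0 < min l b := lt_min hl0 hb
  rw [hmax ha, hmax hb]
  have hlog : Real.log (l / min l b) - Real.log (l / min l a) = Real.log (min l a / min l b) := by
    rw [Real.log_div hl0.ne' hmb.ne', Real.log_div hl0.ne' hma.ne', Real.log_div hma.ne' hmb.ne']
    ring
  rw [hlog]
  refine le_trans ?_ (key hma hmb)
  have h1 : 1 - min l b / min l a = (min l a - min l b) / min l a := by field_simp
  rw [h1]
  rcases le_total a l with h | h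
  · rw [min_eq_right h]
  · rw [min_eq_left h]
    exact div_le_div_of_nonneg_left (sub_nonneg.2 (min_le_left l b)) hl0 h

section Field

variable {Ω : Type*} [MeasurableSpace Ω] {P : Measure Ω} {d K : ℕ}
  {S : Finset (Fin d → ℤ)} {label : S → Fin K} {X : Ω → S → ℝ}
  {m : Fin K → ℝ} {Γ : Fin K → (Fin d → ℤ) → ℝ}

theorem continuous_levelDistortion (r : Fin K) : Continuous (levelDistortion P label X r) := by
  unfold levelDistortion; fun_prop

theorem levelDistortion_mono (r : Fin K) : Monotone (levelDistortion P label X r) := by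
  intro a b hab
  unfold levelDistortion
  gcongr

theorem levelRate_nonneg (r : Fin K) (θ : ℝ) : 0 ≤ levelRate P label X r θ := by
  unfold levelRate
  exact mul_nonneg (by positivity) (Finset.sum_nonneg fun i _ => le_max_right _ _)

theorem levelDistortion_lt_of_lt (r : Fin K) {a b : ℝ} (hab : a < b)
    (ha : levelDistortion P label X r a < regionVariance P label X r) :
    levelDistortion P label X r a < levelDistortion P label X r b := by
  have hn : (0 : ℝ) < 1 / regionSize label r := by
    -- for an empty region both sides of `ha` would be zero
    rcases (Nat.cast_nonneg (α := ℝ) (regionSize label r)).eq_or_lt with h | h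
    · simp [levelDistortion, regionVariance, ← h] at ha
    · positivity
  unfold levelDistortion regionVariance at *
  obtain ⟨i, hi, hlt⟩ := Finset.exists_lt_of_sum_lt (lt_of_mul_lt_mul_left ha hn.le)
  have hai : a < eig P label X r i := by
    by_contra h
    exact hlt.ne (min_eq_left (not_lt.1 h))
  refine mul_lt_mul_of_pos_left (Finset.sum_lt_sum (fun j _ => min_le_min_left _ hab.le)
    ⟨i, hi, ?_⟩) hn
  rw [min_eq_right hai.le]
  exact lt_min hai hab

theorem eig_nonneg (hX : IsPiecewiseGaussian P label X m Γ) (r : Fin K) (i : Region label r) :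
    0 ≤ eig P label X r i := by
  have h : covMatrix P label X r =
      (Matrix.of fun h k : Fin d → ℤ => Γ r (h - k)).submatrix
        (fun s : Region label r => s.1.1) (fun s : Region label r => s.1.1) := by
    ext s t
    simp only [covMatrix, Matrix.of_apply, Matrix.submatrix_apply]
    rw [hX.cov_within _ _ (s.2.trans t.2.symm), s.2]
  have hpsd : (covMatrix P label X r).PosSemidef := h ▸ (hX.posSemidef r).submatrix _
  exact hpsd.eigenvalues_nonneg i

theorem nonempty_region (hX : IsPiecewiseGaussian P label X m Γ) (r : Fin K) :
    Nonempty (Region label r) := by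
  obtain ⟨s, hs⟩ := hX.label_surjective r
  exact ⟨⟨s, hs⟩⟩

theorem regionSize_pos (hX : IsPiecewiseGaussian P label X m Γ) (r : Fin K) :
    (0 : ℝ) < regionSize label r := by
  have := nonempty_region hX r
  exact_mod_cast Fintype.card_pos (α := Region label r)

theorem card_pos (hX : IsPiecewiseGaussian P label X m Γ) (r : Fin K) : (0 : ℝ) < S.card := by
  obtain ⟨s⟩ := nonempty_region hX r
  exact_mod_cast Finset.card_pos.2 ⟨_, s.1.2⟩

theorem weight_pos (hX : IsPiecewiseGaussian P label X m Γ) (r : Fin K) : 0 < weight label r :=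
  div_pos (regionSize_pos hX r) (card_pos hX r)

theorem sum_levelDistortion_lt_of_lt (hX : IsPiecewiseGaussian P label X m Γ) {a b : ℝ}
    (hab : a < b) (ha : ∑ r, weight label r * levelDistortion P label X r a <
      ∑ r, weight label r * regionVariance P label X r) :
    ∑ r, weight label r * levelDistortion P label X r a <
      ∑ r, weight label r * levelDistortion P label X r b := by
  obtain ⟨r, hr, hlt⟩ := Finset.exists_lt_of_sum_lt ha
  refine Finset.sum_lt_sum (fun r _ => mul_le_mul_of_nonneg_left
    (levelDistortion_mono r hab.le) (weight_pos hX r).le) ⟨r, hr, ?_⟩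
  exact mul_lt_mul_of_pos_left (levelDistortion_lt_of_lt r hab
    (lt_of_mul_lt_mul_left hlt (weight_pos hX r).le)) (weight_pos hX r)

theorem exists_sum_levelDistortion_eq (hX : IsPiecewiseGaussian P label X m Γ) {D : ℝ}
    (hD_pos : 0 < D) (hD_lt : D < ∑ r, weight label r * regionVariance P label X r) :
    ∃ θ, 0 < θ ∧ ∑ r, weight label r * levelDistortion P label X r θ = D := by
  -- a level above all eigenvalues, where the distortion is the total variance
  set M : ℝ := ∑ r, ∑ i, eig P label X r i with hM
  have hM0 : 0 ≤ M := Finset.sum_nonneg fun r _ => Finset.sum_nonneg fun i _ => eig_nonneg hX r i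
  have hle : ∀ r i, eig P label X r i ≤ M := fun r i =>
    (Finset.single_le_sum (fun j _ => eig_nonneg hX r j) (Finset.mem_univ i)).trans
      (Finset.single_le_sum (f := fun r => ∑ i, eig P label X r i)
        (fun r _ => Finset.sum_nonneg fun i _ => eig_nonneg hX r i) (Finset.mem_univ r))
  have h0 : ∑ r, weight label r * levelDistortion P label X r 0 = 0 := by
    simp [levelDistortion, min_eq_right (eig_nonneg hX _ _)]
  have h1 : ∑ r, weight label r * levelDistortion P label X r M =
      ∑ r, weight label r * regionVariance P label X r := by
    simp [levelDistortion, regionVariance, min_eq_left (hle _ _)]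
  have hcont : Continuous fun θ => ∑ r, weight label r * levelDistortion P label X r θ :=
    continuous_finsetSum _ fun r _ => (continuous_levelDistortion r).const_mul _
  obtain ⟨θ, hθ, hval⟩ := intermediate_value_Icc hM0 hcont.continuousOn
    (show D ∈ Set.Icc _ _ by rw [h0, h1]; exact ⟨hD_pos.le, hD_lt.le⟩)
  refine ⟨θ, hθ.1.lt_of_ne ?_, hval⟩
  rintro rfl
  exact hD_pos.ne (h0.symm.trans hval)

theorem levelDistortion_sub_div_le (hX : IsPiecewiseGaussian P label X m Γ) (r : Fin K)
    {a b : ℝ} (ha : 0 < a) (hb : 0 < b) :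
    (1 / (2 * a)) * (levelDistortion P label X r a - levelDistortion P label X r b) ≤
      levelRate P label X r b - levelRate P label X r a := by
  have hn := regionSize_pos hX r
  have h := Finset.sum_le_sum fun i (_ : i ∈ Finset.univ) =>
    sub_min_div_le_max_log_sub (eig_nonneg hX r i) ha hb
  rw [← Finset.sum_div, Finset.sum_sub_distrib, Finset.sum_sub_distrib] at h
  have h2 := mul_le_mul_of_nonneg_left h (show 0 ≤ 1 / (2 * (regionSize label r : ℝ)) by positivity)
  unfold levelDistortion levelRate
  calc _ = _ := by field_simp
    _ ≤ _ := h2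
    _ = _ := by ring

/-- The supporting lines `B ↦ R_r(θ') + (D_r(θ') - B) / (2 θ')` of the regional rate-distortion
function touch it at different points: away from `B = D_r(θ)`, the line of level `θ` is exceeded by
that of a nearby level `θ'`. Moving from `θ` to `θ'` raises the value at `B` by at least
`(1 / (2 θ') - 1 / (2 θ)) (D_r(θ') - B)`, so `θ'` is taken below `θ` if `B < D_r(θ)` and above `θ`
otherwise. -/
theorem exists_level_tangent_lt (hX : IsPiecewiseGaussian P label X m Γ) (r : Fin K)
    {θ B : ℝ} (hθ : 0 < θ) (hB : B ≠ levelDistortion P label X r θ) :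
    ∃ θ', 0 < θ' ∧
      levelRate P label X r θ + (1 / (2 * θ)) * (levelDistortion P label X r θ - B) <
        levelRate P label X r θ' + (1 / (2 * θ')) * (levelDistortion P label X r θ' - B) := by
  suffices h : ∃ θ', 0 < θ' ∧
      0 < (1 / (2 * θ') - 1 / (2 * θ)) * (levelDistortion P label X r θ' - B) by
    obtain ⟨θ', h0, h⟩ := h
    have := levelDistortion_sub_div_le hX r hθ h0
    exact ⟨θ', h0, by linarith⟩
  have hc := (continuous_levelDistortion (P := P) (label := label) (X := X) r).tendsto θ
  rcases hB.lt_or_gt with h | h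
  · obtain ⟨θ', ⟨h1, h2⟩, h3⟩ := (((hc.mono_left nhdsWithin_le_nhds).eventually_const_lt h).and
      ((lt_mem_nhds hθ).filter_mono nhdsWithin_le_nhds) |>.and
      (self_mem_nhdsWithin (s := Set.Iio θ))).exists
    have h3' : θ' < θ := h3
    exact ⟨θ', h2, mul_pos (sub_pos.2 (one_div_lt_one_div_of_lt (by linarith)
      (by linarith))) (sub_pos.2 h1)⟩
  · obtain ⟨θ', h1, h3⟩ := (((hc.mono_left nhdsWithin_le_nhds).eventually_lt_const h).and
      (self_mem_nhdsWithin (s := Set.Ioi θ))).exists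
    have h3' : θ < θ' := h3
    exact ⟨θ', hθ.trans h3', mul_pos_of_neg_of_neg (sub_neg.2 (one_div_lt_one_div_of_lt
      (by linarith) (by linarith))) (sub_neg.2 h1)⟩

/-! ### Rates on the water-filling curve and the optimal allocation -/

variable [IsProbabilityMeasure P]

theorem le_regionRate (hX : IsPiecewiseGaussian P label X m Γ) (r : Fin K) {θ : ℝ} (hθ : 0 < θ)
    (B : ℝ) :
    ENNReal.ofReal (levelRate P label X r θ +
      (1 / (2 * θ)) * (levelDistortion P label X r θ - B)) ≤ regionRate P label X r B := by
  obtain ⟨T, T', h⟩ := exists_isGaussianChart_regionField (label := label) hX.gaussian r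
  have := nonempty_region hX r
  have := Measure.isProbabilityMeasure_map
    (hasGaussianLaw_regionField (label := label) hX.gaussian r).aemeasurable
  have := h.le_rateDistortion (Real.toNNReal_pos.2 hθ) B
  simp only [Real.coe_toNNReal _ hθ.le, Real.coe_toNNReal _ (eig_nonneg hX r _)] at this
  exact this

theorem regionRate_levelDistortion (hX : IsPiecewiseGaussian P label X m Γ) (r : Fin K) {θ : ℝ}
    (hθ : 0 < θ) :
    regionRate P label X r (levelDistortion P label X r θ) =
      ENNReal.ofReal (levelRate P label X r θ) := by
  refine le_antisymm ?_ (by simpa using le_regionRate hX r hθ (levelDistortion P label X r θ))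
  obtain ⟨T, T', h⟩ := exists_isGaussianChart_regionField (label := label) hX.gaussian r
  have := nonempty_region hX r
  have := Measure.isProbabilityMeasure_map
    (hasGaussianLaw_regionField (label := label) hX.gaussian r).aemeasurable
  have := h.rateDistortion_le (Real.toNNReal_pos.2 hθ)
  simp only [Real.coe_toNNReal _ hθ.le, Real.coe_toNNReal _ (eig_nonneg hX r _)] at this
  exact this

theorem globalRate_levelDistortion (hX : IsPiecewiseGaussian P label X m Γ) [Nonempty S] {θ : ℝ}
    (hθ : 0 < θ) :
    globalRate P X (∑ r, weight label r * levelDistortion P label X r θ) =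
      ENNReal.ofReal (∑ r, weight label r * levelRate P label X r θ) := by
  obtain ⟨T, T', h⟩ := exists_isGaussianChart_field hX
  have := Measure.isProbabilityMeasure_map hX.gaussian.aemeasurable
  have hle := h.rateDistortion_le (Real.toNNReal_pos.2 hθ)
  have hge := h.le_rateDistortion (Real.toNNReal_pos.2 hθ)
    (∑ r, weight label r * levelDistortion P label X r θ)
  simp only [Real.coe_toNNReal _ hθ.le, Real.coe_toNNReal _ (eig_nonneg hX _ _),
    Fintype.card_coe, Fintype.sum_sigma] at hle hge
  have hD : (1 / (S.card : ℝ)) * ∑ r, ∑ i, min (eig P label X r i) θ =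
      ∑ r, weight label r * levelDistortion P label X r θ := by
    rw [Finset.mul_sum]
    refine Finset.sum_congr rfl fun r _ => ?_
    have := regionSize_pos hX r
    unfold weight levelDistortion
    field_simp
  have hR : (1 / (2 * (S.card : ℝ))) * ∑ r, ∑ i, max (Real.log (eig P label X r i / θ)) 0 =
      ∑ r, weight label r * levelRate P label X r θ := by
    rw [Finset.mul_sum]
    refine Finset.sum_congr rfl fun r _ => ?_
    have := regionSize_pos hX r
    unfold weight levelRate
    field_simp
  rw [hD, hR] at hle hge
  rw [sub_self, mul_zero, add_zero] at hge
  exact le_antisymm hle hge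

/-- A lower bound on the rate of an allocation, with a multiplier of its own for every region. -/
theorem le_allocationRate (hX : IsPiecewiseGaussian P label X m Γ) {θ : Fin K → ℝ}
    (hθ : ∀ r, 0 < θ r) (B : Fin K → ℝ) :
    ENNReal.ofReal (∑ r, weight label r * (levelRate P label X r (θ r) +
      (1 / (2 * θ r)) * (levelDistortion P label X r (θ r) - B r))) ≤
        allocationRate P label X B := by
  refine (ofReal_sum_le _ _).trans (Finset.sum_le_sum fun r _ => ?_)
  rw [ENNReal.ofReal_mul (weight_pos hX r).le]
  gcongr
  exact le_regionRate hX r (hθ r) (B r)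

theorem allocationRate_levelDistortion (hX : IsPiecewiseGaussian P label X m Γ) {θ : ℝ}
    (hθ : 0 < θ) :
    allocationRate P label X (fun r => levelDistortion P label X r θ) =
      ENNReal.ofReal (∑ r, weight label r * levelRate P label X r θ) := by
  rw [ENNReal.ofReal_sum_of_nonneg fun r _ =>
    mul_nonneg (weight_pos hX r).le (levelRate_nonneg r θ)]
  refine Finset.sum_congr rfl fun r _ => ?_
  rw [ENNReal.ofReal_mul (weight_pos hX r).le, regionRate_levelDistortion hX r hθ]

theorem isOptimalAllocation_iff (hX : IsPiecewiseGaussian P label X m Γ) {θ : ℝ} (hθ : 0 < θ)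
    (A : Fin K → ℝ) :
    IsOptimalAllocation P label X (∑ r, weight label r * levelDistortion P label X r θ) A ↔
      ∀ r, A r = levelDistortion P label X r θ := by
  have hsum : ∀ B : Fin K → ℝ,
      IsFeasible label (∑ r, weight label r * levelDistortion P label X r θ) B →
      ∑ r, weight label r * levelRate P label X r θ ≤
        ∑ r, weight label r * (levelRate P label X r θ +
          (1 / (2 * θ)) * (levelDistortion P label X r θ - B r)) := fun B hB => by
    have h1 : ∑ r, weight label r * (levelRate P label X r θ +
          (1 / (2 * θ)) * (levelDistortion P label X r θ - B r)) =
        ∑ r, weight label r * levelRate P label X r θ + (1 / (2 * θ)) *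
          (∑ r, weight label r * levelDistortion P label X r θ - ∑ r, weight label r * B r) := by
      rw [← Finset.sum_sub_distrib, Finset.mul_sum, ← Finset.sum_add_distrib]
      exact Finset.sum_congr rfl fun r _ => by ring
    rw [h1]
    have := mul_nonneg (show 0 ≤ 1 / (2 * θ) by positivity) (sub_nonneg.2 hB)
    linarith
  constructor
  · rintro ⟨hfeas, hopt⟩
    by_contra! hne
    obtain ⟨r₀, hr₀⟩ := hne
    -- all regions keep the slope of level `θ`, except that `r₀` uses a strictly better one
    obtain ⟨θ', hθ', hlt⟩ := exists_level_tangent_lt hX r₀ hθ hr₀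
    have hpos : ∀ r, 0 < Function.update (fun _ : Fin K => θ) r₀ θ' r := fun r => by
      rcases eq_or_ne r r₀ with rfl | h <;> simp [*]
    have hge := (le_allocationRate hX hpos A).trans
      (hopt (fun r => levelDistortion P label X r θ) le_rfl)
    rw [allocationRate_levelDistortion hX hθ] at hge
    refine hge.not_gt ((ENNReal.ofReal_lt_ofReal_iff_of_nonneg (Finset.sum_nonneg fun r _ =>
      mul_nonneg (weight_pos hX r).le (levelRate_nonneg r θ))).2 ((hsum A hfeas).trans_lt ?_))
    refine Finset.sum_lt_sum (fun r _ => ?_) ⟨r₀, Finset.mem_univ _, ?_⟩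
    · rcases eq_or_ne r r₀ with rfl | h
      · rw [Function.update_self]
        exact mul_le_mul_of_nonneg_left hlt.le (weight_pos hX r).le
      · rw [Function.update_of_ne h]
    · rw [Function.update_self]
      exact mul_lt_mul_of_pos_left hlt (weight_pos hX r₀)
  · intro hA
    obtain rfl : A = fun r => levelDistortion P label X r θ := funext hA
    refine ⟨le_rfl, fun B hB => ?_⟩
    rw [allocationRate_levelDistortion hX hθ]
    exact (ENNReal.ofReal_le_ofReal (hsum B hB)).trans (le_allocationRate hX (fun _ => hθ) B)

end Field

end

end PiecewiseRD

theorem mainTheorem6 {Ω : Type*} [MeasurableSpace Ω] (P : Measure Ω) [IsProbabilityMeasure P]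
    {d K : ℕ} {S : Finset (Fin d → ℤ)} (label : S → Fin K) (X : Ω → S → ℝ)
    (m : Fin K → ℝ) (Γ : Fin K → (Fin d → ℤ) → ℝ)
    (hX : IsPiecewiseGaussian P label X m Γ)
    (D : ℝ) (hD_pos : 0 < D)
    (hD_lt : D < ∑ r, weight label r * regionVariance P label X r) :
    ∃ θ : ℝ, 0 < θ ∧
      -- `θ` is the unique solution of the water-level equation
      (∀ θ' : ℝ, ∑ r, weight label r * levelDistortion P label X r θ' = D ↔ θ' = θ) ∧
      -- the optimal allocation is unique, and it is the one induced by the common level `θ`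
      (∀ A : Fin K → ℝ, IsOptimalAllocation P label X D A ↔
        ∀ r, A r = levelDistortion P label X r θ) ∧
      -- every region operates at level `θ`: its rate is the reverse water-filling rate at `θ`
      (∀ r, regionRate P label X r (levelDistortion P label X r θ) =
        ENNReal.ofReal (levelRate P label X r θ)) ∧
      -- and a region in the interior regime has no other water level
      (∀ r, levelDistortion P label X r θ < regionVariance P label X r →
        ∀ θ' : ℝ, levelDistortion P label X r θ' = levelDistortion P label X r θ → θ' = θ) ∧
      -- the global rate-distortion function
      globalRate P X D = ENNReal.ofReal (∑ r, weight label r * levelRate P label X r θ) := by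
  obtain ⟨θ, hθ, rfl⟩ := exists_sum_levelDistortion_eq hX hD_pos hD_lt
  have : Nonempty S := by
    by_contra h
    rw [not_nonempty_iff] at h
    have : IsEmpty (Fin K) := ⟨fun r => h.elim (nonempty_region hX r).some.1⟩
    simp at hD_pos
  refine ⟨θ, hθ, fun θ' => ⟨fun h => ?_, fun h => by rw [h]⟩, isOptimalAllocation_iff hX hθ,
    fun r => regionRate_levelDistortion hX r hθ, fun r hr θ' h => ?_,
    globalRate_levelDistortion hX hθ⟩
  · rcases lt_trichotomy θ' θ with hlt | heq | hlt
    · exact absurd h (sum_levelDistortion_lt_of_lt hX hlt (h ▸ hD_lt)).ne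
    · exact heq
    · exact absurd h.symm (sum_levelDistortion_lt_of_lt hX hlt hD_lt).ne
  · rcases lt_trichotomy θ' θ with hlt | heq | hlt
    · exact absurd h (levelDistortion_lt_of_lt r hlt (h ▸ hr)).ne
    · exact heq
    · exact absurd h.symm (levelDistortion_lt_of_lt r hlt hr).ne
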